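/- Let $K$ be a number field of degree $d$ over $\mathbb{Q}$ and let $\overline{\mathbb{Q}}$ be an algebraic closure of $\mathbb{Q}$ containing $K$. For a place $v$ of $K$ let $d_v=[K_v:\mathbb{Q}_v]$ be the local degree and let $\|\cdot\|_v$ be the absolute value on $K_v$ extending the usual absolute value of $\mathbb{R}$ or $\mathbb{C}$ if $v\mid\infty$, respectively the usual $p$-adic absolute value if $v\mid p$. For $\boldsymbol x=(x_1,\dots,x_n)\in K^n$ put $$H(\boldsymbol x)=\prod_{v\nmid\infty}\max_{1\le i\le n}\|x_i\|_v^{d_v/d}\cdot\prod_{v\mid\infty}\Big(\sum_{i=1}^n\|x_i\|_v^2\Big)^{d_v/(2d)} .$$ This value does not depend on the number field containing the coordinates of $\boldsymbol x$ over which it is computed, so $H$ is defined on $\overline{\mathbb{Q}}^n$. The height $H(F)$ of a polynomial $F$ over $K$ is the height of its vector of coefficients, and the height $H(A)$ of $A\in GL_N(K)$ is the height of $A$ viewed as a vector in $K^{N^2}$. For $\boldsymbol x\in\overline{\mathbb{Q}}^N$ let $\deg_K(\boldsymbol x)=[K(x_1,\dots,x_N):K]$. Theorem. Let $F(X_1,\dots,X_N)$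 be a homogeneous polynomial of degree $M\ge 1$ in $N\ge 2$ variables with coefficients in $K$, and let $A\in GL_N(K)$. Then either there exists $\boldsymbol 0\ne\boldsymbol x\in K^N$ such that $F(\boldsymbol x)=0$ and $$H(\boldsymbol x)\le H(A),$$ or there exists $\boldsymbol x\in A(\overline{\mathbb{Q}}^\times)^N=\{A\boldsymbol z:\boldsymbol z\in\overline{\mathbb{Q}}^N,\ z_i\neq 0 \text{ for all } i\}$ with $\deg_K(\boldsymbol x)\le M$ such that $F(\boldsymbol x)=0$ and $$H(\boldsymbol x)\le C_1(N,M)\,H(A)^2\,H(F)^{1/M},$$ where $$C_1(N,M)=2^{N-1}\left(\frac{M+2}{2}\right)^{\frac{(4M+1)(N-2)}{2M}}\binom{M+N}{N}^{\frac1{2M}}\prod_{j=2}^N\binom{M+j-2}{j-2}^{\frac1{2M}} .$$ -/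

import Mathlib

open NumberField

namespace SearchBounds

noncomputable section

/-- The absolute height of a vector `x` over the number field `K`, with `d = [K : ℚ]`:
the `d`-th root of the product over all places `v` of `K` of the Euclidean norm
`(∑ i, ‖x i‖_v ^ 2) ^ (1 / 2)` raised to the local degree `d_v = v.mult` for archimedean `v`, and of
`max_i ‖x i‖_v ^ d_v` for non-archimedean `v`. Mathlib's `FinitePlace` absolute value of `a` is
`N(v) ^ (- ord_v a)`, which already is `‖a‖_v ^ d_v` for the absolute value `‖ ‖_v` extending
the usual `p`-adic one. The zero vector has height `0`. -/
def height {K : Type*} [Field K] [NumberField K] {ι : Type*} [Fintype ι] (x : ι → K) : ℝ :=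
  ((∏ v : InfinitePlace K, Real.sqrt (∑ i, v (x i) ^ 2) ^ v.mult) *
    ∏ᶠ v : FinitePlace K, ⨆ i, v (x i)) ^ (1 / (Module.finrank ℚ K : ℝ))

/-- The height of a polynomial: the height of its vector of coefficients. (Coefficients equal to
zero do not contribute.) -/
def polyHeight {K : Type*} [Field K] [NumberField K] {σ : Type*} (F : MvPolynomial σ K) : ℝ :=
  height (fun m : F.support => F.coeff m)

/-- The height of an `N × N` matrix, viewed as a vector with `N ^ 2` coordinates. -/
def matrixHeight {K : Type*} [Field K] [NumberField K] {N : ℕ} (A : Matrix (Fin N) (Fin N) K) : ℝ :=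
  height (fun p : Fin N × Fin N => A p.1 p.2)

/-- The field `K(x₁, …, x_N)` generated over `K` by the coordinates of `x`. -/
abbrev coordField (K : Type*) [Field K] {Ω : Type*} [Field Ω] [Algebra K Ω] {N : ℕ}
    (x : Fin N → Ω) : IntermediateField K Ω :=
  IntermediateField.adjoin K (Set.range x)

/-- `deg_K(x) = [K(x₁, …, x_N) : K]`. -/
def degOver (K : Type*) [Field K] {Ω : Type*} [Field Ω] [Algebra K Ω] {N : ℕ}
    (x : Fin N → Ω) : ℕ :=
  Module.finrank K (coordField K x)

theorem coordField_finiteDimensional (K : Type*) [Field K] {Ω : Type*} [Field Ω] [Algebra K Ω]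
    [Algebra.IsAlgebraic K Ω] {N : ℕ} (x : Fin N → Ω) :
    FiniteDimensional K (coordField K x) :=
  IntermediateField.finiteDimensional_adjoin
    (fun _ _ => (Algebra.IsAlgebraic.isAlgebraic _).isIntegral)

instance coordField_numberField (K : Type*) [Field K] [NumberField K] {Ω : Type*} [Field Ω]
    [Algebra K Ω] [Algebra.IsAlgebraic K Ω] {N : ℕ} (x : Fin N → Ω) :
    NumberField (coordField K x) :=
  haveI := coordField_finiteDimensional K x
  NumberField.of_module_finite K (coordField K x)

/-- The absolute height of a vector `x` of elements algebraic over the number field `K`. It can be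
evaluated over any number field that contains the coordinates; here this is `K(x₁, …, x_N)`. -/
def algHeight (K : Type*) [Field K] [NumberField K] {Ω : Type*} [Field Ω]
    [Algebra K Ω] [Algebra.IsAlgebraic K Ω] {N : ℕ} (x : Fin N → Ω) : ℝ :=
  height (fun i : Fin N =>
    (⟨x i, IntermediateField.subset_adjoin K _ (Set.mem_range_self i)⟩ : coordField K x))

/-- The constant `C₁(N, M)`. -/
def C₁ (N M : ℕ) : ℝ :=
  2 ^ (N - 1) *
    (((M : ℝ) + 2) / 2) ^ ((4 * (M : ℝ) + 1) * ((N : ℝ) - 2) / (2 * (M : ℝ))) *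
    (Nat.choose (M + N) N : ℝ) ^ (1 / (2 * (M : ℝ))) *
    ∏ j ∈ Finset.Icc 2 N, (Nat.choose (M + j - 2) (j - 2) : ℝ) ^ (1 / (2 * (M : ℝ)))

end

end SearchBounds

/-! If `F` vanishes at a column of `A`, that column is a subvector of `A`, so its height is at most
`H(A)`. Otherwise fix two indices `i₀ ≠ i₁`. Counting zeros on a grid gives a small integer vector
`t` with `t i₀ = 0`, `t i₁ = 1`, all other entries nonzero and `F(At) ≠ 0`
(`exists_intVec_eval_ne_zero`). The polynomial `B(X) = F(A(t + X e_{i₀}))` has degree exactly `M`,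
because its leading coefficient `b = F(A e_{i₀})` is nonzero, and `0` is not a root, because `B(0) =
F(At)`. Hence each root `α_k` yields a zero `x_k = A(t + α_k e_{i₀})` of `F` of the required shape,
with coordinates in `K(α_k)` and so of degree at most `M`.

The heights are controlled on average over the roots. With `c = √(1 + ∑ t_j²)` at archimedean places
and `c = 1` at finite ones, `‖x_k‖ ≤ c ‖A‖ max(1, |α_k|)`. Moreover `|b| ∏ max(1, |α_k|)` is the
Mahler measure, respectively the Gauss norm, of `B`, and is at most `‖F‖ (c ‖A‖)^M`
(`mul_prod_archNorm_le`, `mul_prod_finNorm_le`). Over all places the product formula removes `b`, so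
`∏ H(x_k) ≤ (1 + ∑ t_j²)^M H(A)^(2M) H(F)`, and some `x_k` is no higher than the geometric mean
(`exists_height_le`). A crude estimate puts `1 + ∑ t_j²` below `C₁`. -/

namespace SearchBounds

open Function

/-! ### Products of local factors and basic properties of heights -/

section PlaceProd

variable {K : Type*} [Field K] [NumberField K]

/-- The Euclidean norm of a vector at an archimedean place. -/
noncomputable def archNorm {ι : Type*} [Fintype ι] (x : ι → K) (v : InfinitePlace K) : ℝ :=
  Real.sqrt (∑ i, v (x i) ^ 2)

/-- The maximum norm of a vector at a non-archimedean place. -/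
noncomputable def finNorm {ι : Type*} (x : ι → K) (v : FinitePlace K) : ℝ :=
  ⨆ i, v (x i)

/-- The product of local factors over all places, with archimedean factors raised to the local
degree. -/
noncomputable def placeProd (g : InfinitePlace K → ℝ) (h : FinitePlace K → ℝ) : ℝ :=
  (∏ v : InfinitePlace K, g v ^ v.mult) * ∏ᶠ v : FinitePlace K, h v

/-- The height relative to `K`, before taking the `[K : ℚ]`-th root. -/
noncomputable def relHeight {ι : Type*} [Fintype ι] (x : ι → K) : ℝ :=
  placeProd (archNorm x) (finNorm x)

theorem height_eq_relHeight_rpow {ι : Type*} [Fintype ι] (x : ι → K) :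
    height x = relHeight x ^ (1 / (Module.finrank ℚ K : ℝ)) := rfl

omit [NumberField K] in
theorem archNorm_nonneg {ι : Type*} [Fintype ι] (x : ι → K) (v : InfinitePlace K) :
    0 ≤ archNorm x v := Real.sqrt_nonneg _

theorem finNorm_nonneg {ι : Type*} (x : ι → K) (v : FinitePlace K) : 0 ≤ finNorm x v :=
  Real.iSup_nonneg fun _ => apply_nonneg v _

theorem le_finNorm {ι : Type*} [Finite ι] (x : ι → K) (v : FinitePlace K) (i : ι) :
    v (x i) ≤ finNorm x v :=
  Finite.le_ciSup (fun i => v (x i)) i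

theorem finNorm_le {ι : Type*} {x : ι → K} {v : FinitePlace K} {c : ℝ} (hc : 0 ≤ c)
    (h : ∀ i, v (x i) ≤ c) : finNorm x v ≤ c :=
  Real.iSup_le h hc

theorem placeProd_nonneg {g : InfinitePlace K → ℝ} {h : FinitePlace K → ℝ}
    (hg : ∀ v, 0 ≤ g v) (hh : ∀ v, 0 ≤ h v) : 0 ≤ placeProd g h :=
  mul_nonneg (Finset.prod_nonneg fun v _ => pow_nonneg (hg v) _) (finprod_nonneg hh)

theorem relHeight_nonneg {ι : Type*} [Fintype ι] (x : ι → K) : 0 ≤ relHeight x :=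
  placeProd_nonneg (archNorm_nonneg x) (finNorm_nonneg x)

theorem relHeight_eq_height_pow {ι : Type*} [Fintype ι] (x : ι → K) :
    relHeight x = height x ^ Module.finrank ℚ K := by
  rw [height_eq_relHeight_rpow, one_div,
    Real.rpow_inv_natCast_pow (relHeight_nonneg x) Module.finrank_pos.ne']

theorem height_nonneg {ι : Type*} [Fintype ι] (x : ι → K) : 0 ≤ height x :=
  Real.rpow_nonneg (relHeight_nonneg x) _

theorem placeProd_mul (g g' : InfinitePlace K → ℝ) {h h' : FinitePlace K → ℝ}
    (hh : h.HasFiniteMulSupport) (hh' : h'.HasFiniteMulSupport) :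
    placeProd (g * g') (h * h') = placeProd g h * placeProd g' h' := by
  simp only [placeProd, Pi.mul_apply, mul_pow, Finset.prod_mul_distrib,
    finprod_mul_distrib hh hh']
  ring

theorem placeProd_one : placeProd (1 : InfinitePlace K → ℝ) (1 : FinitePlace K → ℝ) = 1 := by
  simp [placeProd]

theorem placeProd_const_one (c : ℝ) :
    placeProd (fun _ : InfinitePlace K => c) (1 : FinitePlace K → ℝ) =
      c ^ Module.finrank ℚ K := by
  simp [placeProd, Finset.prod_pow_eq_pow_sum, InfinitePlace.sum_mult_eq]

theorem placeProd_pow (g : InfinitePlace K → ℝ) {h : FinitePlace K → ℝ}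
    (hh : h.HasFiniteMulSupport) (n : ℕ) :
    placeProd (g ^ n) (h ^ n) = placeProd g h ^ n := by
  induction n with
  | zero => simpa using placeProd_one
  | succ n ih =>
    rw [pow_succ, pow_succ, placeProd_mul _ _ (by fun_prop) hh, ih, pow_succ]

theorem placeProd_prod {κ : Type*} (s : Finset κ) (g : κ → InfinitePlace K → ℝ)
    {h : κ → FinitePlace K → ℝ} (hh : ∀ k, (h k).HasFiniteMulSupport) :
    placeProd (fun v => ∏ k ∈ s, g k v) (fun v => ∏ k ∈ s, h k v) =
      ∏ k ∈ s, placeProd (g k) (h k) := by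
  classical
  induction s using Finset.induction_on with
  | empty => exact placeProd_one
  | insert a s ha ih =>
    simp only [Finset.prod_insert ha]
    rw [← ih]
    exact placeProd_mul _ _ (hh a) (Function.HasFiniteMulSupport.prod hh s)

theorem placeProd_mono {g g' : InfinitePlace K → ℝ} {h h' : FinitePlace K → ℝ}
    (hg : ∀ v, 0 ≤ g v) (hgg : ∀ v, g v ≤ g' v) (hh : ∀ v, 0 ≤ h v) (hhh : ∀ v, h v ≤ h' v)
    (hs : h.HasFiniteMulSupport) (hs' : h'.HasFiniteMulSupport) :
    placeProd g h ≤ placeProd g' h' := by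
  unfold placeProd
  exact mul_le_mul
    (Finset.prod_le_prod (fun v _ => pow_nonneg (hg v) _)
      fun v _ => pow_le_pow_left₀ (hg v) (hgg v) _)
    (finprod_le_finprod hs hh hs' hhh) (finprod_nonneg hh)
    (Finset.prod_nonneg fun v _ => pow_nonneg ((hg v).trans (hgg v)) _)

theorem placeProd_apply {b : K} (hb : b ≠ 0) :
    placeProd (fun v => v b) (fun v => v b) = 1 :=
  prod_abs_eq_one hb

/-- The supremum may be restricted to the nonzero coordinates, each of which has absolute value `1`
at almost all places. A zero coordinate would not have this property by itself. -/
theorem finNorm_hasFiniteMulSupport {ι : Type*} [Finite ι] {x : ι → K} (hx : x ≠ 0) :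
    (finNorm x).HasFiniteMulSupport := by
  have : Nonempty {j // x j ≠ 0} := nonempty_subtype.mpr <| ne_iff.mp hx
  have key : (fun v : FinitePlace K => ⨆ i : {j // x j ≠ 0}, v (x i)).HasFiniteMulSupport :=
    Function.HasFiniteMulSupport.iSup fun i => FinitePlace.hasFiniteMulSupport i.2
  convert key with v
  refine le_antisymm (finNorm_le (Real.iSup_nonneg fun _ => apply_nonneg v _) fun j => ?_)
    (ciSup_le fun j => le_finNorm x v j)
  rcases eq_or_ne (x j) 0 with h | h
  · rw [h, map_zero]
    exact Real.iSup_nonneg fun _ => apply_nonneg v _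
  · exact Finite.le_ciSup (fun i : {j // x j ≠ 0} => v (x i)) ⟨j, h⟩

omit [NumberField K] in
theorem archNorm_smul {ι : Type*} [Fintype ι] (c : K) (x : ι → K) (v : InfinitePlace K) :
    archNorm (c • x) v = v c * archNorm x v := by
  simp only [archNorm, Pi.smul_apply, smul_eq_mul, map_mul, mul_pow, ← Finset.mul_sum]
  rw [Real.sqrt_mul (by positivity), Real.sqrt_sq (apply_nonneg v c)]

theorem finNorm_smul {ι : Type*} (c : K) (x : ι → K) (v : FinitePlace K) :
    finNorm (c • x) v = v c * finNorm x v := by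
  simp only [finNorm, Pi.smul_apply, smul_eq_mul, map_mul]
  rw [Real.mul_iSup_of_nonneg (apply_nonneg v c)]

theorem relHeight_smul {ι : Type*} [Fintype ι] {c : K} (hc : c ≠ 0) {x : ι → K} (hx : x ≠ 0) :
    relHeight (c • x) = relHeight x := by
  have h1 : archNorm (c • x) = (fun v : InfinitePlace K => v c) * archNorm x :=
    funext fun v => archNorm_smul c x v
  have h2 : finNorm (c • x) = (fun v : FinitePlace K => v c) * finNorm x :=
    funext fun v => finNorm_smul c x v
  rw [relHeight, h1, h2, placeProd_mul _ _ (FinitePlace.hasFiniteMulSupport hc)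
    (finNorm_hasFiniteMulSupport hx), placeProd_apply hc, one_mul, relHeight]

theorem relHeight_mono {ι κ : Type*} [Fintype ι] [Fintype κ] {x : ι → K} {y : κ → K}
    (hx : x ≠ 0) (hy : y ≠ 0) (h : ∀ v, archNorm x v ≤ archNorm y v)
    (h' : ∀ v, finNorm x v ≤ finNorm y v) : relHeight x ≤ relHeight y :=
  placeProd_mono (archNorm_nonneg x) h (finNorm_nonneg x) h' (finNorm_hasFiniteMulSupport hx)
    (finNorm_hasFiniteMulSupport hy)

theorem height_mono {ι κ : Type*} [Fintype ι] [Fintype κ] {x : ι → K} {y : κ → K}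
    (hx : x ≠ 0) (hy : y ≠ 0) (h : ∀ v, archNorm x v ≤ archNorm y v)
    (h' : ∀ v, finNorm x v ≤ finNorm y v) : height x ≤ height y :=
  Real.rpow_le_rpow (relHeight_nonneg x) (relHeight_mono hx hy h h') (by positivity)

theorem height_comp_le {ι κ : Type*} [Fintype ι] [Fintype κ] (y : κ → K) {f : ι → κ}
    (hf : Injective f) (hx : y ∘ f ≠ 0) : height (y ∘ f) ≤ height y := by
  have hy : y ≠ 0 := by
    rintro rfl
    exact hx rfl
  refine height_mono hx hy (fun v => Real.sqrt_le_sqrt ?_) fun v =>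
    finNorm_le (finNorm_nonneg y v) fun i => le_finNorm y v (f i)
  classical
  calc ∑ i, v ((y ∘ f) i) ^ 2 = ∑ j ∈ Finset.univ.map ⟨f, hf⟩, v (y j) ^ 2 := by simp
    _ ≤ _ := Finset.sum_le_sum_of_subset_of_nonneg (Finset.subset_univ _)
      fun _ _ _ => by positivity

end PlaceProd

/-! ### Invariance of the height under field extension -/

section Extension

variable {K L : Type*} [Field K] [NumberField K] [Field L] [NumberField L] [Algebra K L]

theorem prod_infinitePlace_pow_mult (g : InfinitePlace K → ℝ) :
    ∏ v, g v ^ v.mult = ∏ φ : K →+* ℂ, g (InfinitePlace.mk φ) := by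
  classical
  rw [← Finset.prod_fiberwise Finset.univ InfinitePlace.mk]
  refine Finset.prod_congr rfl fun v _ => ?_
  rw [Finset.prod_congr rfl (g := fun _ => g v)
    (fun φ hφ => by rw [(Finset.mem_filter.mp hφ).2]), Finset.prod_const,
    InfinitePlace.card_filter_mk_eq]

theorem card_extensions_embedding (ψ : K →+* ℂ) :
    Nat.card {φ : L →+* ℂ // φ.comp (algebraMap K L) = ψ} = Module.finrank K L := by
  let _ : Algebra K ℂ := ψ.toAlgebra
  rw [← AlgHom.card K L ℂ]
  rw [← Nat.card_eq_fintype_card]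
  refine Nat.card_congr
    { toFun := fun φ => { toRingHom := φ.1, commutes' := fun r => DFunLike.congr_fun φ.2 r }
      invFun := fun f => ⟨f.toRingHom, RingHom.ext fun r => f.commutes r⟩
      left_inv := fun _ => rfl
      right_inv := fun _ => rfl }

theorem prod_embeddings_comp_algebraMap (g : (K →+* ℂ) → ℝ) :
    ∏ φ : L →+* ℂ, g (φ.comp (algebraMap K L)) = (∏ ψ, g ψ) ^ Module.finrank K L := by
  classical
  rw [← Finset.prod_fiberwise Finset.univ (fun φ : L →+* ℂ => φ.comp (algebraMap K L)),
    ← Finset.prod_pow]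
  refine Finset.prod_congr rfl fun ψ _ => ?_
  rw [Finset.prod_congr rfl (g := fun _ => g ψ)
    (fun φ hφ => by rw [(Finset.mem_filter.mp hφ).2]), Finset.prod_const,
    ← card_extensions_embedding (L := L) ψ, Nat.card_eq_fintype_card, Fintype.card_subtype]

/-- Local degrees turn products over places into products over complex embeddings, and every
embedding of `K` has `[L : K]` extensions to `L`. -/
theorem prod_archNorm_algebraMap {ι : Type*} [Fintype ι] (x : ι → K) :
    ∏ w : InfinitePlace L, archNorm (fun i => algebraMap K L (x i)) w ^ w.mult =
      (∏ v : InfinitePlace K, archNorm x v ^ v.mult) ^ Module.finrank K L := by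
  rw [prod_infinitePlace_pow_mult, prod_infinitePlace_pow_mult, ← prod_embeddings_comp_algebraMap]
  rfl

/-- For an integral vector the finite part is the inverse of the norm of the ideal generated by its
coordinates, and extending an ideal to `𝓞 L` raises its norm to the power `[L : K]`. No
place-by-place comparison is needed. -/
theorem finprod_finNorm_algebraMap {ι : Type*} [Finite ι] {x : ι → 𝓞 K} (hx : x ≠ 0) :
    ∏ᶠ w : FinitePlace L, finNorm (fun i => algebraMap K L (x i)) w =
      (∏ᶠ v : FinitePlace K, finNorm (fun i => (x i : K)) v) ^ Module.finrank K L := by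
  set y : ι → 𝓞 L := fun i => algebraMap (𝓞 K) (𝓞 L) (x i) with hy
  have hy0 : y ≠ 0 := by
    intro h
    refine hx (funext fun i => ?_)
    have := congrFun h i
    simpa [hy] using this
  have h1 := absNorm_mul_finprod_finitePlace_eq_one hx
  have h2 := absNorm_mul_finprod_finitePlace_eq_one hy0
  have h3 : Ideal.span (Set.range y) =
      (Ideal.span (Set.range x)).map (algebraMap (𝓞 K) (𝓞 L)) := by
    rw [Ideal.map_span, ← Set.range_comp]
    rfl
  have h4 : (Ideal.span (Set.range y)).absNorm =
      (Ideal.span (Set.range x)).absNorm ^ Module.finrank K L := by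
    rw [h3, Ideal.absNorm_algebraMap]
    rw [IsFractionRing.finrank_eq (𝓞 K) K (𝓞 L) L]
  rw [h4] at h2
  push_cast at h2
  have h5 := congrArg (· ^ Module.finrank K L) h1
  simp only [mul_pow, one_pow] at h5
  have h0 : ((Ideal.span (Set.range x)).absNorm : ℝ) ^ Module.finrank K L ≠ 0 :=
    left_ne_zero_of_mul_eq_one h5
  exact mul_left_cancel₀ h0 (h2.trans h5.symm)

/-- Clearing a common denominator reduces to integral vectors, since scaling does not change the
relative height. -/
theorem relHeight_algebraMap {ι : Type*} [Fintype ι] {x : ι → K} (hx : x ≠ 0) :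
    relHeight (fun i => algebraMap K L (x i)) = relHeight x ^ Module.finrank K L := by
  obtain ⟨d, hd⟩ := IsLocalization.exist_integer_multiples_of_finite (nonZeroDivisors (𝓞 K)) x
  choose y hy using hd
  have hd0 : (d : 𝓞 K) ≠ 0 := nonZeroDivisors.coe_ne_zero d
  have hdK : ((d : 𝓞 K) : K) ≠ 0 := by simp
  have hy' : (fun i => (y i : K)) = ((d : 𝓞 K) : K) • x := by
    funext i
    exact (hy i).trans (Algebra.smul_def _ _)
  have hy0 : y ≠ 0 := by
    rintro rfl
    refine hx (funext fun i => ?_)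
    have := congrFun hy' i
    simpa [hd0] using this.symm
  have hxL : (fun i => algebraMap K L (x i)) ≠ 0 := fun h => hx (funext fun i => by
    simpa using congrFun h i)
  have hyL : (fun i => algebraMap K L (y i)) =
      algebraMap K L ((d : 𝓞 K) : K) • fun i => algebraMap K L (x i) := by
    funext i
    have := congrFun hy' i
    simp only [Pi.smul_apply, smul_eq_mul] at this ⊢
    rw [this, map_mul]
  rw [← relHeight_smul (c := algebraMap K L ((d : 𝓞 K) : K)) (by simp [hd0]) hxL, ← hyL,
    ← relHeight_smul hdK hx, ← hy', relHeight, relHeight, placeProd, placeProd,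
    prod_archNorm_algebraMap, finprod_finNorm_algebraMap hy0, mul_pow]

theorem height_algebraMap {ι : Type*} [Fintype ι] {x : ι → K} (hx : x ≠ 0) :
    height (fun i => algebraMap K L (x i)) = height x := by
  rw [height_eq_relHeight_rpow, height_eq_relHeight_rpow, relHeight_algebraMap hx,
    ← Real.rpow_natCast, ← Real.rpow_mul (relHeight_nonneg x),
    ← Module.finrank_mul_finrank ℚ K L]
  have h1 : (Module.finrank K L : ℝ) ≠ 0 := by
    exact_mod_cast (Module.finrank_pos (R := K) (M := L)).ne'
  congr 1
  push_cast
  field_simp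

end Extension

/-! ### Restriction of a form to a line -/

section LinearSubstitution

/-- The univariate polynomial `F (u X + w)`. -/
noncomputable def restrictLine {K ι : Type*} [CommRing K] (F : MvPolynomial ι K) (u w : ι → K) :
    Polynomial K :=
  MvPolynomial.aeval (fun i => Polynomial.C (u i) * Polynomial.X + Polynomial.C (w i)) F

theorem eval_restrictLine {K ι : Type*} [CommRing K] (F : MvPolynomial ι K) (u w : ι → K) (z : K) :
    (restrictLine F u w).eval z = MvPolynomial.eval (fun i => u i * z + w i) F := by
  rw [restrictLine, ← Polynomial.coe_evalRingHom, MvPolynomial.aeval_def,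
    MvPolynomial.hom_eval₂, MvPolynomial.eval, MvPolynomial.coe_eval₂Hom]
  congr 1
  · ext; simp
  · ext i; simp

theorem map_restrictLine {K R ι : Type*} [CommRing K] [CommRing R] (f : K →+* R)
    (F : MvPolynomial ι K) (u w : ι → K) :
    (restrictLine F u w).map f = restrictLine (F.map f) (fun i => f (u i)) (fun i => f (w i)) := by
  rw [restrictLine, restrictLine, ← Polynomial.coe_mapRingHom, MvPolynomial.aeval_def,
    MvPolynomial.hom_eval₂, MvPolynomial.aeval_def, MvPolynomial.eval₂_map]
  congr 1
  · ext; simp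
  · ext i; simp

theorem natDegree_le_and_coeff_prod_linear {K ι : Type*} [CommRing K] (s : Finset ι) (m : ι → ℕ)
    (u w : ι → K) :
    (∏ i ∈ s, (Polynomial.C (u i) * Polynomial.X + Polynomial.C (w i)) ^ m i).natDegree ≤
        ∑ i ∈ s, m i ∧
      (∏ i ∈ s, (Polynomial.C (u i) * Polynomial.X + Polynomial.C (w i)) ^ m i).coeff
        (∑ i ∈ s, m i) = ∏ i ∈ s, u i ^ m i := by
  classical
  have hl : ∀ i, (Polynomial.C (u i) * Polynomial.X + Polynomial.C (w i)).natDegree ≤ 1 :=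
    fun i => Polynomial.natDegree_linear_le
  have hp : ∀ i, ((Polynomial.C (u i) * Polynomial.X + Polynomial.C (w i)) ^ m i).natDegree ≤
      m i := fun i => by simpa using Polynomial.natDegree_pow_le_of_le (m i) (hl i)
  induction s using Finset.induction_on with
  | empty => simp
  | insert a s ha ih =>
    simp only [Finset.prod_insert ha, Finset.sum_insert ha]
    refine ⟨Polynomial.natDegree_mul_le_of_le (hp a) ih.1, ?_⟩
    rw [Polynomial.coeff_mul_add_eq_of_natDegree_le (hp a) ih.1, ih.2]
    have := Polynomial.coeff_pow_of_natDegree_le (m := m a) (hl a)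
    rw [mul_one] at this
    rw [this]
    simp

theorem natDegree_restrictLine_le {K ι : Type*} [CommRing K] [Fintype ι] {F : MvPolynomial ι K}
    {M : ℕ} (hF : F.IsHomogeneous M) (u w : ι → K) : (restrictLine F u w).natDegree ≤ M := by
  rw [restrictLine, MvPolynomial.aeval_def, MvPolynomial.eval₂_eq']
  refine Polynomial.natDegree_sum_le_of_forall_le _ _ fun m hm => ?_
  have hd : ∑ i, m i = M := by
    rw [← Finsupp.degree_eq_sum]
    exact hF.degree_eq_sum_deg_support hm ▸ rfl
  rw [← hd]
  exact (Polynomial.natDegree_C_mul_le _ _).trans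
    (natDegree_le_and_coeff_prod_linear Finset.univ m u w).1

theorem coeff_restrictLine {K ι : Type*} [CommRing K] [Fintype ι] {F : MvPolynomial ι K}
    {M : ℕ} (hF : F.IsHomogeneous M) (u w : ι → K) :
    (restrictLine F u w).coeff M = MvPolynomial.eval u F := by
  rw [restrictLine, MvPolynomial.aeval_def, MvPolynomial.eval₂_eq', MvPolynomial.eval_eq',
    Polynomial.finsetSum_coeff]
  refine Finset.sum_congr rfl fun m hm => ?_
  have hd : ∑ i, m i = M := by
    rw [← Finsupp.degree_eq_sum]
    exact hF.degree_eq_sum_deg_support hm ▸ rfl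
  rw [← hd, Polynomial.algebraMap_eq, Polynomial.coeff_C_mul,
    (natDegree_le_and_coeff_prod_linear Finset.univ m u w).2]

end LinearSubstitution

/-! ### Archimedean estimates via the Mahler measure -/

section Archimedean

/-- In the multinomial expansion of the right side every such monomial occurs with coefficient at
least `1`. -/
theorem sum_prod_pow_le {ι : Type*} [Fintype ι] {y : ι → ℝ} (hy : ∀ i, 0 ≤ y i) (M : ℕ)
    (s : Finset (ι →₀ ℕ)) (hs : ∀ m ∈ s, ∑ i, m i = M) :
    ∑ m ∈ s, ∏ i, y i ^ m i ≤ (∑ i, y i) ^ M := by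
  classical
  rw [Finset.sum_pow_eq_sum_piAntidiag]
  have hinj : Set.InjOn (fun m : ι →₀ ℕ => (m : ι → ℕ)) s :=
    DFunLike.coe_injective.injOn
  calc ∑ m ∈ s, ∏ i, y i ^ m i = ∑ k ∈ s.image (fun m : ι →₀ ℕ => (m : ι → ℕ)),
        ∏ i, y i ^ k i := by rw [Finset.sum_image hinj]
    _ ≤ ∑ k ∈ Finset.piAntidiag Finset.univ M, ∏ i, y i ^ k i := by
        refine Finset.sum_le_sum_of_subset_of_nonneg ?_
          fun k _ _ => Finset.prod_nonneg fun i _ => pow_nonneg (hy i) _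
        intro k hk
        obtain ⟨m, hm, rfl⟩ := Finset.mem_image.mp hk
        simp [Finset.mem_piAntidiag, hs m hm]
    _ ≤ _ := by
        refine Finset.sum_le_sum fun k _ => le_mul_of_one_le_left
          (Finset.prod_nonneg fun i _ => pow_nonneg (hy i) _) ?_
        exact_mod_cast Nat.multinomial_pos _ _

/-- Cauchy–Schwarz separates coefficients from monomials; `sum_prod_pow_le`, applied to the `‖y i‖ ^
2`, bounds the monomial part. -/
theorem norm_eval_map_le {K ι : Type*} [Field K] [Fintype ι] (φ : K →+* ℂ)
    {F : MvPolynomial ι K} {M : ℕ} (hF : F.IsHomogeneous M) (y : ι → ℂ) :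
    ‖MvPolynomial.eval y (F.map φ)‖ ≤
      √(∑ m : F.support, ‖φ (F.coeff m)‖ ^ 2) * √(∑ i, ‖y i‖ ^ 2) ^ M := by
  rw [MvPolynomial.eval_map, MvPolynomial.eval₂_eq', ← Finset.sum_coe_sort]
  refine (norm_sum_le _ _).trans ?_
  simp only [norm_mul]
  refine (Real.sum_mul_le_sqrt_mul_sqrt _ _ _).trans ?_
  refine mul_le_mul_of_nonneg_left ?_ (Real.sqrt_nonneg _)
  refine Real.sqrt_le_iff.mpr ⟨by positivity, ?_⟩
  rw [← pow_mul, mul_comm M, pow_mul, Real.sq_sqrt (by positivity)]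
  rw [Finset.sum_coe_sort F.support fun m => ‖∏ i, y i ^ m i‖ ^ 2]
  simp only [norm_prod, norm_pow, ← Finset.prod_pow, pow_right_comm _ _ 2]
  refine sum_prod_pow_le (fun i => by positivity) M _ fun m hm => ?_
  rw [← Finsupp.degree_eq_sum]
  exact hF.degree_eq_sum_deg_support hm ▸ rfl

theorem sqrt_sum_norm_mulVec_le {ι κ : Type*} [Fintype ι] [Fintype κ] (a : Matrix κ ι ℂ)
    (z : ι → ℂ) :
    √(∑ i, ‖(a.mulVec z) i‖ ^ 2) ≤ √(∑ p : κ × ι, ‖a p.1 p.2‖ ^ 2) * √(∑ j, ‖z j‖ ^ 2) := by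
  rw [← Real.sqrt_mul (by positivity), Fintype.sum_prod_type, Finset.sum_mul]
  refine Real.sqrt_le_sqrt (Finset.sum_le_sum fun i _ => ?_)
  calc ‖(a.mulVec z) i‖ ^ 2 ≤ (∑ j, ‖a i j‖ * ‖z j‖) ^ 2 := by
        gcongr
        exact (norm_sum_le _ _).trans (by simp)
    _ ≤ _ := Finset.sum_mul_sq_le_sq_mul_sq _ _ _

theorem sqrt_sum_norm_update_le {ι : Type*} [Fintype ι] [DecidableEq ι] (t : ι → ℤ) (i₀ : ι)
    (α : ℂ) :
    √(∑ j, ‖update (fun i => (t i : ℂ)) i₀ α j‖ ^ 2) ≤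
      √(1 + ∑ j, (t j : ℝ) ^ 2) * max 1 ‖α‖ := by
  have h1 : (0 : ℝ) ≤ max 1 ‖α‖ := by positivity
  rw [← Real.sqrt_sq h1, ← Real.sqrt_mul (by positivity)]
  refine Real.sqrt_le_sqrt ?_
  have h2 : (1 : ℝ) ≤ max 1 ‖α‖ ^ 2 := one_le_pow₀ (le_max_left _ _)
  rw [add_mul, one_mul, Finset.sum_mul,
    ← Finset.add_sum_erase _ _ (Finset.mem_univ i₀),
    ← Finset.add_sum_erase _ (fun j => (t j : ℝ) ^ 2 * max 1 ‖α‖ ^ 2) (Finset.mem_univ i₀)]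
  have h3 : ‖update (fun i => (t i : ℂ)) i₀ α i₀‖ ^ 2 ≤ max 1 ‖α‖ ^ 2 := by
    rw [update_self]
    gcongr
    exact le_max_right _ _
  have h4 : ∑ j ∈ Finset.univ.erase i₀, ‖update (fun i => (t i : ℂ)) i₀ α j‖ ^ 2 ≤
      ∑ j ∈ Finset.univ.erase i₀, (t j : ℝ) ^ 2 * max 1 ‖α‖ ^ 2 := by
    refine Finset.sum_le_sum fun j hj => ?_
    rw [update_of_ne (Finset.ne_of_mem_erase hj)]
    simp only [Complex.norm_intCast, sq_abs]
    exact le_mul_of_one_le_right (sq_nonneg _) h2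
  have h5 : 0 ≤ (t i₀ : ℝ) ^ 2 * max 1 ‖α‖ ^ 2 := by positivity
  linarith

/-- The Mahler measure is at most the `ℓ²` norm of the coefficients, which by Parseval is the
quadratic mean of `p` on the unit circle. -/
theorem mahlerMeasure_le_of_norm_eval_le {p : Polynomial ℂ} {c : ℝ}
    (h : ∀ z : ℂ, ‖z‖ = 1 → ‖p.eval z‖ ≤ c) : p.mahlerMeasure ≤ c := by
  have hc : 0 ≤ c := (norm_nonneg _).trans (h 1 (by simp))
  refine p.mahlerMeasure_le_sqrt_sum_sq_norm_coeff.trans ?_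
  rw [← Real.sqrt_sq hc]
  refine Real.sqrt_le_sqrt ?_
  have key := Real.circleAverage_mono_on_of_le_circle (f := fun z => ‖p.eval z‖ ^ 2) (c := 0)
    (R := 1) (a := c ^ 2) (ContinuousOn.circleIntegrable' (by fun_prop)) (fun z hz => by
      have := h z (by simpa using hz)
      gcongr)
  rw [← p.sum_sq_norm_coeff_eq_circleAverage] at key
  simpa [Polynomial.sum] using key

theorem mahlerMeasure_C_mul_prod {κ : Type*} [Fintype κ] (b : ℂ) (α : κ → ℂ) :
    (Polynomial.C b * ∏ k, (Polynomial.X - Polynomial.C (α k))).mahlerMeasure =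
      ‖b‖ * ∏ k, max 1 ‖α k‖ := by
  rw [Polynomial.mahlerMeasure_mul, Polynomial.mahlerMeasure_const, Finset.prod,
    Polynomial.prod_mahlerMeasure_eq_mahlerMeasure_prod, Multiset.map_map, Finset.prod]
  simp

variable {L ι : Type*} [Field L] [NumberField L] [Fintype ι] [DecidableEq ι]

omit [NumberField L] in
theorem archNorm_eq_norm_embedding {κ : Type*} [Fintype κ] (x : κ → L) (v : InfinitePlace L) :
    archNorm x v = √(∑ i, ‖v.embedding (x i)‖ ^ 2) := by
  simp [archNorm, InfinitePlace.norm_embedding_eq]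

omit [NumberField L] in
theorem archNorm_mulVec_update_le (A : Matrix ι ι L) (t : ι → ℤ) (i₀ : ι) (α : L)
    (v : InfinitePlace L) :
    archNorm (A.mulVec (update (fun i => (t i : L)) i₀ α)) v ≤
      √(1 + ∑ j, (t j : ℝ) ^ 2) * archNorm (fun p : ι × ι => A p.1 p.2) v * max 1 (v α) := by
  rw [archNorm_eq_norm_embedding, archNorm_eq_norm_embedding, ← InfinitePlace.norm_embedding_eq]
  have h := sqrt_sum_norm_mulVec_le (A.map v.embedding)
    (update (fun i => (t i : ℂ)) i₀ (v.embedding α))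
  have h' : ∀ i, (A.map v.embedding).mulVec (update (fun i => (t i : ℂ)) i₀ (v.embedding α)) i =
      v.embedding (A.mulVec (update (fun i => (t i : L)) i₀ α) i) := fun i => by
    rw [RingHom.map_mulVec, Function.comp_update]
    simp [Function.comp_def]
  simp only [h', Matrix.map_apply] at h
  refine h.trans ((mul_le_mul_of_nonneg_left (sqrt_sum_norm_update_le t i₀ _)
    (Real.sqrt_nonneg _)).trans_eq ?_)
  ring

-- The left side is the Mahler measure of `B`, so it suffices to bound `B` on the unit circle. There
-- `B(ζ)` is `F` at `A` times the vector `t` with `ζ` in position `i₀`.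
omit [NumberField L] in
theorem mul_prod_max_le_arch {κ : Type*} [Fintype κ] {F : MvPolynomial ι L} {M : ℕ}
    (hF : F.IsHomogeneous M) (A : Matrix ι ι L) {t : ι → ℤ} {i₀ : ι} (ht : t i₀ = 0)
    {b : L} {α : κ → L}
    (h : restrictLine F (A.mulVec (Pi.single i₀ 1)) (A.mulVec fun i => (t i : L)) =
      Polynomial.C b * ∏ k, (Polynomial.X - Polynomial.C (α k))) (v : InfinitePlace L) :
    v b * ∏ k, max 1 (v (α k)) ≤
      archNorm (fun m : F.support => F.coeff m) v *
        (√(1 + ∑ j, (t j : ℝ) ^ 2) * archNorm (fun p : ι × ι => A p.1 p.2) v) ^ M := by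
  have hm := congrArg (Polynomial.map v.embedding) h
  simp only [Polynomial.map_mul, Polynomial.map_prod, Polynomial.map_sub, Polynomial.map_C,
    Polynomial.map_X] at hm
  simp only [← InfinitePlace.norm_embedding_eq v, ← mahlerMeasure_C_mul_prod, ← hm]
  refine mahlerMeasure_le_of_norm_eval_le fun ζ hζ => ?_
  rw [map_restrictLine, eval_restrictLine]
  refine (norm_eval_map_le v.embedding hF _).trans ?_
  rw [← archNorm_eq_norm_embedding (fun m : F.support => F.coeff m) v]
  refine mul_le_mul_of_nonneg_left ?_ (archNorm_nonneg _ _)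
  refine pow_le_pow_left₀ (Real.sqrt_nonneg _) ?_ _
  have h' : (fun i => v.embedding (A.mulVec (Pi.single i₀ 1) i) * ζ +
      v.embedding (A.mulVec (fun i => (t i : L)) i)) =
      (A.map v.embedding).mulVec (update (fun i => (t i : ℂ)) i₀ ζ) := by
    have hu : update (fun i => (t i : ℂ)) i₀ ζ = ζ • Pi.single i₀ 1 + fun i => (t i : ℂ) := by
      ext j
      by_cases hj : j = i₀
      · subst hj
        simp [ht]
      · simp [hj]
    rw [hu, Matrix.mulVec_add, Matrix.mulVec_smul]
    ext i
    simp only [Pi.add_apply, Pi.smul_apply, smul_eq_mul, RingHom.map_mulVec]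
    rw [mul_comm]
    congr 3
    · ext j
      by_cases hj : j = i₀
      · subst hj
        simp
      · simp [hj]
    · ext j
      simp
  have h2 := sqrt_sum_norm_mulVec_le (A.map v.embedding) (update (fun i => (t i : ℂ)) i₀ ζ)
  rw [← h'] at h2
  refine h2.trans ((mul_le_mul_of_nonneg_left (sqrt_sum_norm_update_le t i₀ _)
    (Real.sqrt_nonneg _)).trans_eq ?_)
  rw [hζ, max_self, mul_one, mul_comm, archNorm_eq_norm_embedding]
  rfl

omit [NumberField L] in
theorem mul_prod_archNorm_le {κ : Type*} [Fintype κ] {F : MvPolynomial ι L}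
    (hF : F.IsHomogeneous (Fintype.card κ)) (A : Matrix ι ι L) {t : ι → ℤ} {i₀ : ι}
    (ht : t i₀ = 0) {b : L} {α : κ → L}
    (h : restrictLine F (A.mulVec (Pi.single i₀ 1)) (A.mulVec fun i => (t i : L)) =
      Polynomial.C b * ∏ k, (Polynomial.X - Polynomial.C (α k))) (v : InfinitePlace L) :
    v b * ∏ k, archNorm (A.mulVec (update (fun i => (t i : L)) i₀ (α k))) v ≤
      (1 + ∑ j, (t j : ℝ) ^ 2) ^ Fintype.card κ *
        (archNorm (fun m : F.support => F.coeff m) v *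
          archNorm (fun p : ι × ι => A p.1 p.2) v ^ (2 * Fintype.card κ)) := by
  set S := √(1 + ∑ j, (t j : ℝ) ^ 2) with hS
  set a := archNorm (fun p : ι × ι => A p.1 p.2) v
  have ha : 0 ≤ S * a := mul_nonneg (Real.sqrt_nonneg _) (archNorm_nonneg _ _)
  have hS2 : S ^ 2 = 1 + ∑ j, (t j : ℝ) ^ 2 := Real.sq_sqrt (by positivity)
  calc v b * ∏ k, archNorm (A.mulVec (update (fun i => (t i : L)) i₀ (α k))) v
      ≤ v b * ∏ k, (S * a * max 1 (v (α k))) := by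
        refine mul_le_mul_of_nonneg_left ?_ (apply_nonneg v b)
        exact Finset.prod_le_prod (fun k _ => archNorm_nonneg _ _)
          fun k _ => archNorm_mulVec_update_le A t i₀ (α k) v
    _ = (S * a) ^ Fintype.card κ * (v b * ∏ k, max 1 (v (α k))) := by
        rw [Finset.prod_mul_distrib, Finset.prod_const, Finset.card_univ]
        ring
    -- One power of `S * a` comes from the vectors and one from the Mahler measure: hence the
    -- exponent `2` on `H(A)` and the factor `S ^ 2 = 1 + ∑ t_j²`.
    _ ≤ (S * a) ^ Fintype.card κ *
        (archNorm (fun m : F.support => F.coeff m) v * (S * a) ^ Fintype.card κ) :=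
        mul_le_mul_of_nonneg_left (mul_prod_max_le_arch hF A ht h v) (pow_nonneg ha _)
    _ = _ := by
        rw [← hS2]
        ring

end Archimedean

/-! ### Non-archimedean estimates via the Gauss norm -/

section Nonarchimedean

variable {L ι : Type*} [Field L] [NumberField L] [Fintype ι] [DecidableEq ι]

theorem isNonarchimedean_finitePlace (v : FinitePlace L) : IsNonarchimedean v.val :=
  fun x y => FinitePlace.add_le v x y

theorem finitePlace_intCast_le_one (v : FinitePlace L) (n : ℤ) : v (n : L) ≤ 1 :=
  (isNonarchimedean_finitePlace v).apply_intCast_le_one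

omit [DecidableEq ι] in
theorem finNorm_mulVec_le (A : Matrix ι ι L) (z : ι → L) (v : FinitePlace L) :
    finNorm (A.mulVec z) v ≤ finNorm (fun p : ι × ι => A p.1 p.2) v * finNorm z v := by
  have h0 := mul_nonneg (finNorm_nonneg (fun p : ι × ι => A p.1 p.2) v) (finNorm_nonneg z v)
  refine finNorm_le h0 fun i => ?_
  refine ((isNonarchimedean_finitePlace v).apply_sum_univ_le (l := fun j => A i j * z j)).trans
    (Real.iSup_le (fun j => ?_) h0)
  rw [map_mul]
  exact mul_le_mul (le_finNorm (fun p : ι × ι => A p.1 p.2) v (i, j)) (le_finNorm z v j)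
    (apply_nonneg v _) (finNorm_nonneg _ v)

omit [Fintype ι] in
theorem finNorm_update_intCast_le (t : ι → ℤ) (i₀ : ι) (α : L) (v : FinitePlace L) :
    finNorm (update (fun i => (t i : L)) i₀ α) v ≤ max 1 (v α) := by
  refine finNorm_le (by positivity) fun i => ?_
  by_cases hi : i = i₀
  · subst hi
    simp
  · rw [update_of_ne hi]
    exact (finitePlace_intCast_le_one v _).trans (le_max_left _ _)

theorem gaussNorm_prod {κ : Type*} (v : FinitePlace L) (s : Finset κ) (p : κ → Polynomial L) :
    (∏ k ∈ s, p k).gaussNorm v.val 1 = ∏ k ∈ s, (p k).gaussNorm v.val 1 := by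
  classical
  induction s using Finset.induction_on with
  | empty =>
    rw [Finset.prod_empty, Finset.prod_empty, ← Polynomial.C_1, Polynomial.gaussNorm_C, map_one]
  | insert a s ha ih =>
    rw [Finset.prod_insert ha, Finset.prod_insert ha,
      Polynomial.gaussNorm_mul (isNonarchimedean_finitePlace v) one_pos, ih]

theorem gaussNorm_pow (v : FinitePlace L) (p : Polynomial L) (n : ℕ) :
    (p ^ n).gaussNorm v.val 1 = p.gaussNorm v.val 1 ^ n := by
  simpa using gaussNorm_prod v (Finset.range n) fun _ => p

theorem max_le_gaussNorm_X_sub_C (v : FinitePlace L) (α : L) :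
    max 1 (v α) ≤ (Polynomial.X - Polynomial.C α).gaussNorm v.val 1 := by
  have h := (Polynomial.X - Polynomial.C α).le_gaussNorm v.val zero_le_one
  refine max_le ((h 1).trans_eq' ?_) ((h 0).trans_eq' ?_)
  · simp [Polynomial.coeff_X]
  · simp [FinitePlace.coe_apply]

theorem gaussNorm_linear_le {v : FinitePlace L} {a b : L} {c : ℝ} (ha : v a ≤ c) (hb : v b ≤ c) :
    (Polynomial.C a * Polynomial.X + Polynomial.C b).gaussNorm v.val 1 ≤ c := by
  refine (Polynomial.isNonarchimedean_gaussNorm v.val (isNonarchimedean_finitePlace v)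
    zero_le_one _ _).trans (max_le ?_ ?_)
  · rw [Polynomial.C_mul_X_eq_monomial, Polynomial.gaussNorm_monomial]
    simpa [FinitePlace.coe_apply] using ha
  · rw [Polynomial.gaussNorm_C]
    exact hb

-- The Gauss norm is ultrametric and multiplicative, so one term of `F` dominates, and it is a
-- coefficient times `M` linear factors of norm at most `c`.
omit [DecidableEq ι] in
theorem gaussNorm_restrictLine_le {F : MvPolynomial ι L} {M : ℕ} (hF : F.IsHomogeneous M)
    {u w : ι → L} {v : FinitePlace L} {c : ℝ} (hc : 0 ≤ c) (hu : ∀ i, v (u i) ≤ c)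
    (hw : ∀ i, v (w i) ≤ c) :
    (restrictLine F u w).gaussNorm v.val 1 ≤
      finNorm (fun m : F.support => F.coeff m) v * c ^ M := by
  have h0 : 0 ≤ finNorm (fun m : F.support => F.coeff m) v * c ^ M :=
    mul_nonneg (finNorm_nonneg _ v) (pow_nonneg hc M)
  rw [restrictLine, MvPolynomial.aeval_def, MvPolynomial.eval₂_eq']
  rcases F.support.eq_empty_or_nonempty with hs | hs
  · rw [hs, Finset.sum_empty, Polynomial.gaussNorm_zero]
    rwa [hs] at h0
  obtain ⟨m, hm, hle⟩ := IsNonarchimedean.finset_image_add_of_nonempty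
    (Polynomial.isNonarchimedean_gaussNorm v.val (isNonarchimedean_finitePlace v) zero_le_one)
    (fun m => algebraMap L (Polynomial L) (F.coeff m) *
      ∏ i, (Polynomial.C (u i) * Polynomial.X + Polynomial.C (w i)) ^ m i) hs
  refine hle.trans ?_
  rw [Polynomial.gaussNorm_mul (isNonarchimedean_finitePlace v) one_pos, gaussNorm_prod,
    Polynomial.algebraMap_eq, Polynomial.gaussNorm_C]
  have hd : ∑ i, m i = M := by
    rw [← Finsupp.degree_eq_sum]
    exact hF.degree_eq_sum_deg_support hm ▸ rfl
  refine mul_le_mul (le_finNorm (fun m : F.support => F.coeff m) v ⟨m, hm⟩) ?_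
    (Finset.prod_nonneg fun i _ => Polynomial.gaussNorm_nonneg _ _ zero_le_one)
    (finNorm_nonneg _ v)
  rw [← hd, ← Finset.prod_pow_eq_pow_sum]
  refine Finset.prod_le_prod (fun i _ => Polynomial.gaussNorm_nonneg _ _ zero_le_one) fun i _ => ?_
  rw [gaussNorm_pow]
  exact pow_le_pow_left₀ (Polynomial.gaussNorm_nonneg _ _ zero_le_one)
    (gaussNorm_linear_le (hu i) (hw i)) _

/-- Counterpart of `mul_prod_archNorm_le`. The entries of `t` are integers, hence of absolute value
at most `1`, so no constant depending on `t` appears. -/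
theorem mul_prod_finNorm_le {κ : Type*} [Fintype κ] {F : MvPolynomial ι L}
    (hF : F.IsHomogeneous (Fintype.card κ)) (A : Matrix ι ι L) {t : ι → ℤ} {i₀ : ι}
    {b : L} {α : κ → L}
    (h : restrictLine F (A.mulVec (Pi.single i₀ 1)) (A.mulVec fun i => (t i : L)) =
      Polynomial.C b * ∏ k, (Polynomial.X - Polynomial.C (α k))) (v : FinitePlace L) :
    v b * ∏ k, finNorm (A.mulVec (update (fun i => (t i : L)) i₀ (α k))) v ≤
      finNorm (fun m : F.support => F.coeff m) v *
          finNorm (fun p : ι × ι => A p.1 p.2) v ^ (2 * Fintype.card κ) := by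
  set a := finNorm (fun p : ι × ι => A p.1 p.2) v
  have ha : 0 ≤ a := finNorm_nonneg _ _
  have hcol : ∀ z : ι → L, (∀ j, v (z j) ≤ 1) → ∀ i, v (A.mulVec z i) ≤ a := fun z hz i =>
    (le_finNorm _ v i).trans ((finNorm_mulVec_le A z v).trans
      (mul_le_of_le_one_right ha (finNorm_le zero_le_one hz)))
  have hg := gaussNorm_restrictLine_le hF ha
    (hcol (Pi.single i₀ 1) fun j => by
      by_cases hj : j = i₀
      · subst hj
        simp
      · simp [hj])
    (hcol (fun i => (t i : L)) fun j => finitePlace_intCast_le_one v _)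
  rw [h, Polynomial.gaussNorm_mul (isNonarchimedean_finitePlace v) one_pos, gaussNorm_prod,
    Polynomial.gaussNorm_C] at hg
  calc v b * ∏ k, finNorm (A.mulVec (update (fun i => (t i : L)) i₀ (α k))) v
      ≤ v b * ∏ k, (a * (Polynomial.X - Polynomial.C (α k)).gaussNorm v.val 1) := by
        refine mul_le_mul_of_nonneg_left ?_ (apply_nonneg v b)
        refine Finset.prod_le_prod (fun k _ => finNorm_nonneg _ _) fun k _ => ?_
        exact (finNorm_mulVec_le A _ v).trans (mul_le_mul_of_nonneg_left
          ((finNorm_update_intCast_le t i₀ (α k) v).trans (max_le_gaussNorm_X_sub_C v _)) ha)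
    _ = a ^ Fintype.card κ *
        (v.val b * ∏ k, (Polynomial.X - Polynomial.C (α k)).gaussNorm v.val 1) := by
        rw [Finset.prod_mul_distrib, Finset.prod_const, Finset.card_univ, FinitePlace.coe_apply]
        ring
    _ ≤ a ^ Fintype.card κ *
        (finNorm (fun m : F.support => F.coeff m) v * a ^ Fintype.card κ) :=
        mul_le_mul_of_nonneg_left hg (pow_nonneg ha _)
    _ = _ := by ring

end Nonarchimedean

/-! ### Multiplying over all places and choosing a root -/

section RootHeights

variable {L ι : Type*} [Field L] [NumberField L] [Fintype ι] [DecidableEq ι]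

/-- The product formula for `b` lets `|b|_v` be inserted at every place, after which the local
estimates multiply together. -/
theorem prod_relHeight_le {κ : Type*} [Fintype κ] {F : MvPolynomial ι L}
    (hF : F.IsHomogeneous (Fintype.card κ)) (hF0 : F ≠ 0) {A : Matrix ι ι L} {t : ι → ℤ} {i₀ : ι}
    (ht : t i₀ = 0) {b : L} (hb : b ≠ 0) {α : κ → L}
    (h : restrictLine F (A.mulVec (Pi.single i₀ 1)) (A.mulVec fun i => (t i : L)) =
      Polynomial.C b * ∏ k, (Polynomial.X - Polynomial.C (α k)))
    (hA : (fun p : ι × ι => A p.1 p.2) ≠ 0)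
    (hx : ∀ k, A.mulVec (update (fun i => (t i : L)) i₀ (α k)) ≠ 0) :
    ∏ k, relHeight (A.mulVec (update (fun i => (t i : L)) i₀ (α k))) ≤
      ((1 + ∑ j, (t j : ℝ) ^ 2) ^ Fintype.card κ) ^ Module.finrank ℚ L *
        (relHeight (fun m : F.support => F.coeff m) *
          relHeight (fun p : ι × ι => A p.1 p.2) ^ (2 * Fintype.card κ)) := by
  have hF0' : (fun m : F.support => F.coeff m) ≠ 0 := by
    obtain ⟨m, hm⟩ := MvPolynomial.support_nonempty.mpr hF0
    exact fun h0 => MvPolynomial.mem_support_iff.mp hm (congrFun h0 ⟨m, hm⟩)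
  have hsF := finNorm_hasFiniteMulSupport hF0'
  have hsA := finNorm_hasFiniteMulSupport hA
  have hsx := fun k => finNorm_hasFiniteMulSupport (hx k)
  have hsb := FinitePlace.hasFiniteMulSupport hb
  have hsp := Function.HasFiniteMulSupport.prod hsx Finset.univ
  calc ∏ k, relHeight (A.mulVec (update (fun i => (t i : L)) i₀ (α k)))
      = placeProd (fun v => v b) (fun v => v b) *
          ∏ k, relHeight (A.mulVec (update (fun i => (t i : L)) i₀ (α k))) := by
        rw [placeProd_apply hb, one_mul]
    _ = placeProd _ _ := by
        simp only [relHeight]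
        rw [← placeProd_prod Finset.univ _ hsx, ← placeProd_mul _ _ hsb hsp]
    _ ≤ placeProd _ _ := by
        refine placeProd_mono ?_ (mul_prod_archNorm_le hF A ht h) ?_ (mul_prod_finNorm_le hF A h)
          (hsb.mul hsp) (hsF.mul (hsA.pow _))
        · exact fun v => mul_nonneg (apply_nonneg v b)
            (Finset.prod_nonneg fun k _ => archNorm_nonneg _ v)
        · exact fun v => mul_nonneg (apply_nonneg v b)
            (Finset.prod_nonneg fun k _ => finNorm_nonneg _ v)
    _ = _ := by
        rw [← placeProd_const_one, relHeight, relHeight, ← placeProd_pow _ hsA,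
          ← placeProd_mul _ _ hsF (hsA.pow _), ← placeProd_mul _ _ (by fun_prop)
          (hsF.mul (hsA.pow _)), one_mul]
        rfl

theorem exists_height_le {κ : Type*} [Fintype κ] [Nonempty κ] {F : MvPolynomial ι L}
    (hF : F.IsHomogeneous (Fintype.card κ)) (hF0 : F ≠ 0) {A : Matrix ι ι L} {t : ι → ℤ} {i₀ : ι}
    (ht : t i₀ = 0) {b : L} (hb : b ≠ 0) {α : κ → L}
    (h : restrictLine F (A.mulVec (Pi.single i₀ 1)) (A.mulVec fun i => (t i : L)) =
      Polynomial.C b * ∏ k, (Polynomial.X - Polynomial.C (α k)))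
    (hA : (fun p : ι × ι => A p.1 p.2) ≠ 0)
    (hx : ∀ k, A.mulVec (update (fun i => (t i : L)) i₀ (α k)) ≠ 0) :
    ∃ k, height (A.mulVec (update (fun i => (t i : L)) i₀ (α k))) ≤
      (1 + ∑ j, (t j : ℝ) ^ 2) * height (fun p : ι × ι => A p.1 p.2) ^ 2 *
        polyHeight F ^ (1 / (Fintype.card κ : ℝ)) := by
  set n := Fintype.card κ with hn
  have hn0 : n ≠ 0 := Fintype.card_ne_zero
  set d := Module.finrank ℚ L with hd
  have hd0 : d ≠ 0 := Module.finrank_pos.ne'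
  set s : ℝ := 1 + ∑ j, (t j : ℝ) ^ 2 with hs
  have hs0 : 0 ≤ s := by positivity
  have key := prod_relHeight_le hF hF0 ht hb h hA hx
  by_contra! hlt
  have hP : polyHeight F = (polyHeight F ^ (1 / (n : ℝ))) ^ n := by
    rw [one_div, Real.rpow_inv_natCast_pow (by exact height_nonneg _) hn0]
  set q := polyHeight F ^ (1 / (n : ℝ)) with hq
  have hq0 : 0 ≤ q := Real.rpow_nonneg (height_nonneg _) _
  set a := height (fun p : ι × ι => A p.1 p.2) with ha
  have ha0 : 0 ≤ a := height_nonneg _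
  have hc0 : 0 ≤ s * a ^ 2 * q := by positivity
  have hF' : height (fun m : F.support => F.coeff m) = q ^ n := hP
  have h1 : ∏ _k : κ, (s * a ^ 2 * q) ^ d <
      ∏ k, relHeight (A.mulVec (update (fun i => (t i : L)) i₀ (α k))) := by
    simp only [relHeight_eq_height_pow]
    -- Strict comparison of products needs positive factors on the smaller side, so a vanishing
    -- bound is handled apart.
    rcases hc0.eq_or_lt with hc | hc
    · rw [← hc] at hlt ⊢
      rw [zero_pow hd0, Finset.prod_const, zero_pow Finset.univ_nonempty.card_ne_zero]
      exact Finset.prod_pos fun k _ => pow_pos (hlt k) _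
    · exact Finset.prod_lt_prod_of_nonempty (fun _ _ => pow_pos hc _)
        (fun k _ => pow_lt_pow_left₀ (hlt k) hc.le hd0) Finset.univ_nonempty
  rw [Finset.prod_const, Finset.card_univ, ← hn] at h1
  rw [← hn, ← hs, ← hd, relHeight_eq_height_pow (fun m : F.support => F.coeff m),
    relHeight_eq_height_pow (fun p : ι × ι => A p.1 p.2), hF', ← ha, ← hd] at key
  refine absurd (h1.trans_le key) (not_lt.mpr (le_of_eq ?_))
  ring_nf

end RootHeights

/-! ### A small integer vector avoiding the zeros of the form -/

section IntegerDirection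

theorem exists_intVec_eval_ne_zero {K ι : Type*} [Field K] [CharZero K] [Fintype ι]
    [DecidableEq ι] {F : MvPolynomial ι K} {M : ℕ} (hF : F.IsHomogeneous M) (A : Matrix ι ι K)
    {i₀ i₁ : ι} (hi : i₀ ≠ i₁) (h : MvPolynomial.eval (A.mulVec (Pi.single i₁ 1)) F ≠ 0) :
    ∃ t : ι → ℤ, t i₀ = 0 ∧ t i₁ = 1 ∧ (∀ j, j ≠ i₀ → t j ≠ 0) ∧
      (∀ j, |t j| ≤ ((M + 2) / 2 : ℕ)) ∧
      MvPolynomial.eval (A.mulVec fun j => (t j : K)) F ≠ 0 := by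
  set m := (M + 2) / 2 with hm
  -- `P` is `F ∘ A` with coordinate `i₀` set to `0` and coordinate `i₁` to `1`. It has degree at
  -- most `M`, and its value at the origin is `F(A e_{i₁}) ≠ 0`.
  set ℓ : ι → MvPolynomial ι K := fun j => if j = i₀ then 0 else if j = i₁ then 1 else
    MvPolynomial.X j with hℓ
  set Y : ι → MvPolynomial ι K := fun i => ∑ j, MvPolynomial.C (A i j) * ℓ j with hY
  set P : MvPolynomial ι K := MvPolynomial.aeval Y F with hP
  have hYdeg : ∀ i, (Y i).totalDegree ≤ 1 := fun i => by
    refine MvPolynomial.totalDegree_finsetSum_le fun j _ => ?_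
    refine (MvPolynomial.totalDegree_mul _ _).trans ?_
    rw [MvPolynomial.totalDegree_C, zero_add]
    simp only [hℓ]
    split_ifs <;> simp
  have hPdeg : P.totalDegree ≤ M := by
    rw [hP, MvPolynomial.aeval_def, MvPolynomial.eval₂_eq']
    refine MvPolynomial.totalDegree_finsetSum_le fun d hd => ?_
    refine (MvPolynomial.totalDegree_mul _ _).trans ?_
    rw [MvPolynomial.algebraMap_eq, MvPolynomial.totalDegree_C, zero_add]
    have hdM : ∑ i, d i = M := by
      rw [← Finsupp.degree_eq_sum]
      exact hF.degree_eq_sum_deg_support hd ▸ rfl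
    rw [← hdM]
    refine (MvPolynomial.totalDegree_finsetProd _ _).trans (Finset.sum_le_sum fun i _ => ?_)
    exact (MvPolynomial.totalDegree_pow _ _).trans (by
      simpa using Nat.mul_le_mul_left (d i) (hYdeg i))
  have hPeval : ∀ x : ι → K, MvPolynomial.eval x P =
      MvPolynomial.eval (A.mulVec fun j => if j = i₀ then 0 else if j = i₁ then 1 else x j) F := by
    intro x
    rw [hP, MvPolynomial.aeval_def, MvPolynomial.hom_eval₂]
    change _ = MvPolynomial.eval₂ (RingHom.id K) _ F
    congr 1
    · ext; simp
    · ext i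
      simp only [hY, map_sum, map_mul, MvPolynomial.eval_C, Matrix.mulVec, dotProduct]
      refine Finset.sum_congr rfl fun j _ => ?_
      simp only [hℓ]
      split_ifs <;> simp
  have hP0 : P ≠ 0 := by
    intro h0
    have := hPeval 0
    rw [h0, map_zero] at this
    refine h (this.trans ?_).symm
    congr 3
    funext j
    by_cases h1 : j = i₁
    · subst h1
      simp [hi.symm]
    · simp [h1]
  -- The nonzero integers in `[-m, m]` number `2m = 2⌊(M + 2) / 2⌋ ≥ M + 1`, more than the degree of
  -- `P` in any variable, so `P` cannot vanish on the whole grid.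
  set S : Finset K := ((Finset.Icc (-(m : ℤ)) m).erase 0).map
    ⟨fun n : ℤ => (n : K), Int.cast_injective⟩ with hS
  have hcard : M < S.card := by
    rw [hS, Finset.card_map, Finset.card_erase_of_mem (by simp), Int.card_Icc]
    omega
  obtain ⟨x, hxS, hx⟩ : ∃ x : ι → K, (∀ i, x i ∈ S) ∧ MvPolynomial.eval x P ≠ 0 := by
    by_contra! hcon
    exact hP0 (MvPolynomial.eq_zero_of_eval_zero_at_prod_finset P (fun _ => S)
      (fun i => ((MvPolynomial.degreeOf_le_totalDegree P i).trans hPdeg).trans_lt hcard) hcon)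
  have hx' : ∀ i, ∃ n : ℤ, n ≠ 0 ∧ |n| ≤ m ∧ (n : K) = x i := fun i => by
    obtain ⟨n, hn, hnx⟩ := Finset.mem_map.mp (hxS i)
    rw [Finset.mem_erase, Finset.mem_Icc] at hn
    exact ⟨n, hn.1, abs_le.mpr hn.2, hnx⟩
  choose n hn0 hnm hnx using hx'
  have hm1 : (1 : ℤ) ≤ m := by omega
  refine ⟨fun j => if j = i₀ then 0 else if j = i₁ then 1 else n j, by simp,
    by simp [hi.symm], fun j hj => ?_, fun j => ?_, ?_⟩
  · simp only [hj, if_false]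
    split_ifs
    · exact one_ne_zero
    · exact hn0 j
  · dsimp only
    split_ifs
    · simp
    · simpa using hm1
    · exact hnm j
  · rw [hPeval] at hx
    convert hx using 4 with j
    push_cast
    simp only [hnx]

end IntegerDirection

/-! ### Comparison with the constant `C₁` -/

section Constant

theorem two_add_mul_sq_le_C₁ {N M : ℕ} (hN : 2 ≤ N) (hM : 1 ≤ M) :
    2 + ((N : ℝ) - 2) * (((M : ℝ) + 2) / 2) ^ 2 ≤ C₁ N M := by
  obtain ⟨k, rfl⟩ := Nat.exists_eq_add_of_le hN
  set μ : ℝ := ((M : ℝ) + 2) / 2 with hμ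
  have hM' : (1 : ℝ) ≤ M := by exact_mod_cast hM
  have hμ1 : 1 ≤ μ := by rw [hμ]; linarith
  have hk : (((2 + k : ℕ) : ℝ) - 2) = k := by push_cast; ring
  have h1 : 2 + (k : ℝ) * μ ^ 2 ≤ 2 ^ (k + 1) * μ ^ (2 * k) := by
    -- Bernoulli's inequality, followed by `1 + μ² ≤ 2μ²`, replaces the sum by a power.
    have hb := one_add_mul_le_pow (a := μ ^ 2) (by nlinarith) k
    have hμ2 : 1 ≤ μ ^ 2 := one_le_pow₀ hμ1
    have hc : (1 + μ ^ 2) ^ k ≤ (2 * μ ^ 2) ^ k :=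
      pow_le_pow_left₀ (by positivity) (by linarith) k
    have hkμ : 0 ≤ (k : ℝ) * μ ^ 2 := by positivity
    calc 2 + (k : ℝ) * μ ^ 2 ≤ 2 * (2 * μ ^ 2) ^ k := by linarith
      _ = _ := by rw [mul_pow, pow_succ, pow_mul]; ring
  have h2 : μ ^ (2 * k) ≤ μ ^ ((4 * (M : ℝ) + 1) * (k : ℝ) / (2 * (M : ℝ))) := by
    rw [← Real.rpow_natCast]
    refine Real.rpow_le_rpow_of_exponent_le hμ1 ?_
    rw [le_div_iff₀ (by positivity)]
    push_cast
    nlinarith [(Nat.cast_nonneg k : (0 : ℝ) ≤ k)]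
  have hexp : (0 : ℝ) ≤ 1 / (2 * (M : ℝ)) := by positivity
  -- The binomial factors of `C₁` are only needed to be at least `1`.
  have h3 : 1 ≤ (Nat.choose (M + (2 + k)) (2 + k) : ℝ) ^ (1 / (2 * (M : ℝ))) :=
    Real.one_le_rpow (by exact_mod_cast Nat.choose_pos (by omega)) hexp
  have h4 : 1 ≤ ∏ j ∈ Finset.Icc 2 (2 + k),
      (Nat.choose (M + j - 2) (j - 2) : ℝ) ^ (1 / (2 * (M : ℝ))) :=
    Finset.one_le_prod fun j _ =>
      Real.one_le_rpow (by exact_mod_cast Nat.choose_pos (by omega)) hexp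
  rw [hk, C₁, hk, ← hμ, show 2 + k - 1 = k + 1 by omega]
  have h5 : 2 ^ (k + 1) * μ ^ (2 * k) ≤
      2 ^ (k + 1) * μ ^ ((4 * (M : ℝ) + 1) * (k : ℝ) / (2 * (M : ℝ))) := by gcongr
  have h6 : 0 ≤ 2 ^ (k + 1) * μ ^ ((4 * (M : ℝ) + 1) * (k : ℝ) / (2 * (M : ℝ))) := by positivity
  exact (h1.trans h5).trans ((le_mul_of_one_le_right h6 h3).trans
    (le_mul_of_one_le_right (h6.trans (le_mul_of_one_le_right h6 h3)) h4))

theorem one_add_sum_sq_le_C₁ {N M : ℕ} (hN : 2 ≤ N) (hM : 1 ≤ M) {t : Fin N → ℤ} {i₀ i₁ : Fin N}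
    (hi : i₀ ≠ i₁) (h₀ : t i₀ = 0) (h₁ : t i₁ = 1) (ht : ∀ j, |t j| ≤ ((M + 2) / 2 : ℕ)) :
    1 + ∑ j, (t j : ℝ) ^ 2 ≤ C₁ N M := by
  refine le_trans ?_ (two_add_mul_sq_le_C₁ hN hM)
  have hmem : i₁ ∈ Finset.univ.erase i₀ := Finset.mem_erase.mpr ⟨hi.symm, Finset.mem_univ _⟩
  rw [← Finset.add_sum_erase _ _ (Finset.mem_univ i₀), ← Finset.add_sum_erase _ _ hmem, h₀, h₁]
  have hcard : (((Finset.univ.erase i₀).erase i₁).card : ℝ) = (N : ℝ) - 2 := by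
    rw [Finset.card_erase_of_mem hmem, Finset.card_erase_of_mem (Finset.mem_univ _),
      Finset.card_univ, Fintype.card_fin, Nat.sub_sub, Nat.cast_sub hN]
    norm_num
  have hle : ∀ j, (t j : ℝ) ^ 2 ≤ (((M : ℝ) + 2) / 2) ^ 2 := fun j => by
    have h1 : |(t j : ℝ)| ≤ (((M + 2) / 2 : ℕ) : ℝ) := by
      have := Int.cast_le (R := ℝ).mpr (ht j)
      rwa [Int.cast_abs, Int.cast_natCast] at this
    have h2 : (((M + 2) / 2 : ℕ) : ℝ) ≤ ((M : ℝ) + 2) / 2 := by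
      simpa using Nat.cast_div_le (α := ℝ) (m := M + 2) (n := 2)
    rw [← sq_abs (t j : ℝ)]
    exact pow_le_pow_left₀ (abs_nonneg _) (h1.trans h2) 2
  have hsum := Finset.sum_le_card_nsmul ((Finset.univ.erase i₀).erase i₁)
    (fun j => (t j : ℝ) ^ 2) _ fun j _ => hle j
  rw [nsmul_eq_mul, hcard] at hsum
  push_cast
  linarith

end Constant

/-! ### Passage between `K`, the splitting field and the algebraic closure -/

section Transfer

theorem polyHeight_map {K L ι : Type*} [Field K] [NumberField K] [Field L] [NumberField L]
    [Algebra K L] {F : MvPolynomial ι K} (hF : F ≠ 0) :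
    polyHeight (F.map (algebraMap K L)) = polyHeight F := by
  have hF' : (fun m : F.support => F.coeff m) ≠ 0 := by
    obtain ⟨m, hm⟩ := MvPolynomial.support_nonempty.mpr hF
    exact fun h0 => MvPolynomial.mem_support_iff.mp hm (congrFun h0 ⟨m, hm⟩)
  -- The mapped polynomial is indexed by its own support, equal to `F.support` only propositionally;
  -- a variable `s` allows substitution.
  have hs : ∀ s : Finset (ι →₀ ℕ), s = F.support →
      height (fun m : s => algebraMap K L (F.coeff m)) =
        height (fun m : F.support => algebraMap K L (F.coeff m)) := by
    rintro s rfl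
    rfl
  rw [polyHeight, polyHeight, ← height_algebraMap (L := L) hF']
  simp only [MvPolynomial.coeff_map]
  exact hs _ (MvPolynomial.support_map_of_injective _ (algebraMap K L).injective)

/-- Used to compute the height of a zero in the field generated by all roots, where the estimate
averaging over roots takes place. -/
theorem algHeight_eq_height {K Ω : Type*} [Field K] [NumberField K] [Field Ω] [Algebra K Ω]
    [Algebra.IsAlgebraic K Ω] {N : ℕ} {x : Fin N → Ω} (hx : x ≠ 0) (L : IntermediateField K Ω)
    [NumberField L] (y : Fin N → L) (hy : ∀ i, (y i : Ω) = x i) :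
    algHeight K x = height y := by
  have hle : coordField K x ≤ L := by
    refine IntermediateField.adjoin_le_iff.mpr ?_
    rintro _ ⟨i, rfl⟩
    rw [← hy i]
    exact (y i).2
  let _ : Algebra (coordField K x) L := (IntermediateField.inclusion hle).toAlgebra
  rw [algHeight, ← height_algebraMap (L := L)]
  · congr 1
    ext i
    exact (hy i).symm
  · intro h0
    exact hx (funext fun i => congrArg Subtype.val (congrFun h0 i))

theorem degOver_le_of_mem_adjoin_simple {K Ω : Type*} [Field K] [Field Ω] [Algebra K Ω] {N : ℕ}
    {x : Fin N → Ω} {α : Ω} (hx : ∀ i, x i ∈ IntermediateField.adjoin K {α}) {p : Polynomial K}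
    (hp : p ≠ 0) (hα : Polynomial.aeval α p = 0) : degOver K x ≤ p.natDegree := by
  have hint : IsIntegral K α := isAlgebraic_iff_isIntegral.mp ⟨p, hp, hα⟩
  have hle : coordField K x ≤ IntermediateField.adjoin K {α} := by
    refine IntermediateField.adjoin_le_iff.mpr ?_
    rintro _ ⟨i, rfl⟩
    exact hx i
  have := IntermediateField.adjoin.finiteDimensional hint
  calc degOver K x ≤ Module.finrank K (IntermediateField.adjoin K {α}) :=
        LinearMap.finrank_le_finrank_of_injective
          (f := (IntermediateField.inclusion hle).toLinearMap)
          (IntermediateField.inclusion_injective hle)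
    _ = (minpoly K α).natDegree := IntermediateField.adjoin.finrank hint
    _ ≤ p.natDegree := Polynomial.natDegree_le_of_dvd (minpoly.dvd K α hα) hp

theorem mulVec_ne_zero_of_isUnit {K ι : Type*} [Field K] [Fintype ι] [DecidableEq ι]
    {A : Matrix ι ι K} (hA : IsUnit A) {z : ι → K} (hz : z ≠ 0) : A.mulVec z ≠ 0 := fun h =>
  hz (Matrix.mulVec_injective_of_isUnit hA (by rw [h, Matrix.mulVec_zero]))

theorem exists_eq_C_mul_prod_X_sub_C {Ω : Type*} [Field Ω] {p : Polynomial Ω} (hp : p.Splits)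
    {M : ℕ} (hM : p.natDegree = M) : ∃ α : Fin M → Ω,
      p = Polynomial.C p.leadingCoeff * ∏ k, (Polynomial.X - Polynomial.C (α k)) := by
  obtain ⟨l, hl⟩ := Quot.exists_rep p.roots
  have hcard : l.length = M := by
    rw [← hM, hp.natDegree_eq_card_roots, ← hl]
    rfl
  subst hcard
  refine ⟨l.get, ?_⟩
  conv_lhs => rw [hp.eq_prod_roots, ← hl]
  congr 1
  rw [← List.prod_ofFn]
  change ((l : Multiset Ω).map _).prod = _
  rw [Multiset.map_coe, Multiset.prod_coe, ← List.ofFn_get l, List.map_ofFn]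
  simp [Function.comp_def]

theorem exists_zero_height_le {K Ω : Type*} [Field K] [NumberField K] [Field Ω] [Algebra K Ω]
    [IsAlgClosed Ω] [Algebra.IsAlgebraic K Ω] {N M : ℕ} (hM : 1 ≤ M)
    {F : MvPolynomial (Fin N) K} (hF : F.IsHomogeneous M) {A : Matrix (Fin N) (Fin N) K}
    (hA : IsUnit A) {t : Fin N → ℤ} {i₀ i₁ : Fin N} (h₀ : t i₀ = 0) (h₁ : t i₁ = 1)
    (ht : ∀ j, j ≠ i₀ → t j ≠ 0)
    (hFu : MvPolynomial.eval (A.mulVec (Pi.single i₀ 1)) F ≠ 0)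
    (hFw : MvPolynomial.eval (A.mulVec fun j => (t j : K)) F ≠ 0) :
    ∃ z : Fin N → Ω, (∀ i, z i ≠ 0) ∧
      degOver K ((A.map (algebraMap K Ω)).mulVec z) ≤ M ∧
      MvPolynomial.aeval ((A.map (algebraMap K Ω)).mulVec z) F = 0 ∧
      algHeight K ((A.map (algebraMap K Ω)).mulVec z) ≤
        (1 + ∑ j, (t j : ℝ) ^ 2) * matrixHeight A ^ 2 * polyHeight F ^ (1 / (M : ℝ)) := by
  have : CharZero Ω := charZero_of_injective_algebraMap (algebraMap K Ω).injective
  have hi : i₁ ≠ i₀ := by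
    rintro rfl
    exact zero_ne_one (h₀.symm.trans h₁)
  have hF0 : F ≠ 0 := by
    rintro rfl
    exact hFu (map_zero _)
  set B := restrictLine F (A.mulVec (Pi.single i₀ 1)) (A.mulVec fun j => (t j : K)) with hB
  have hBc : B.coeff M ≠ 0 := by rwa [hB, coeff_restrictLine hF]
  have hBdeg : B.natDegree = M :=
    le_antisymm (natDegree_restrictLine_le hF _ _) (Polynomial.le_natDegree_of_ne_zero hBc)
  have hB0 : B ≠ 0 := by
    intro h
    exact hBc (by rw [h, Polynomial.coeff_zero])
  have hlc : B.leadingCoeff ≠ 0 := Polynomial.leadingCoeff_ne_zero.mpr hB0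
  obtain ⟨α, hfac⟩ := exists_eq_C_mul_prod_X_sub_C (IsAlgClosed.splits (B.map (algebraMap K Ω)))
    ((Polynomial.natDegree_map _).trans hBdeg)
  rw [Polynomial.leadingCoeff_map] at hfac
  have hne : Nonempty (Fin M) := ⟨⟨0, hM⟩⟩
  set L : IntermediateField K Ω := IntermediateField.adjoin K (Set.range α)
  have hLfin : FiniteDimensional K L := IntermediateField.finiteDimensional_adjoin
    fun _ _ => (Algebra.IsAlgebraic.isAlgebraic _).isIntegral
  have hLnf : NumberField L := NumberField.of_module_finite K L
  let β : Fin M → L := fun k => ⟨α k, IntermediateField.subset_adjoin K _ (Set.mem_range_self k)⟩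
  have hBL : restrictLine (F.map (algebraMap K L)) ((A.map (algebraMap K L)).mulVec
      (Pi.single i₀ 1)) ((A.map (algebraMap K L)).mulVec fun j => (t j : L)) =
      Polynomial.C (algebraMap K L B.leadingCoeff) *
        ∏ k, (Polynomial.X - Polynomial.C (β k)) := by
    have h1 : restrictLine (F.map (algebraMap K L)) ((A.map (algebraMap K L)).mulVec
        (Pi.single i₀ 1)) ((A.map (algebraMap K L)).mulVec fun j => (t j : L)) =
        B.map (algebraMap K L) := by
      rw [hB, map_restrictLine]
      congr 1
      · ext i
        rw [RingHom.map_mulVec]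
        congr 2
        ext j
        by_cases hj : j = i₀
        · subst hj
          simp
        · simp [hj]
      · ext i
        rw [RingHom.map_mulVec]
        congr 2
        ext j
        simp
    rw [h1]
    apply Polynomial.map_injective (algebraMap L Ω) (algebraMap L Ω).injective
    rw [Polynomial.map_map, ← IsScalarTower.algebraMap_eq, hfac]
    simp only [Polynomial.map_mul, Polynomial.map_prod, Polynomial.map_sub, Polynomial.map_C,
      Polynomial.map_X, ← IsScalarTower.algebraMap_apply]
    rfl
  have hAL : IsUnit (A.map (algebraMap K L)) := hA.map (algebraMap K L).mapMatrix
  -- The entry `1` at `i₁` keeps the vector nonzero whatever is placed at `i₀`.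
  have hz0 : ∀ α : L, update (fun j => (t j : L)) i₀ α ≠ 0 := fun α h => by
    have := congrFun h i₁
    simp [hi, h₁] at this
  have hA0 : (fun p : Fin N × Fin N => A p.1 p.2) ≠ 0 := by
    intro h
    refine mulVec_ne_zero_of_isUnit hA (z := Pi.single i₀ 1) (by simp) ?_
    have : A = 0 := by
      ext i j
      exact congrFun h (i, j)
    rw [this, Matrix.zero_mulVec]
  have hAL0 : (fun p : Fin N × Fin N => (A.map (algebraMap K L)) p.1 p.2) ≠ 0 := fun h =>
    hA0 (funext fun p => by simpa using congrFun h p)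
  have hFL : F.map (algebraMap K L) ≠ 0 := fun h =>
    hF0 (MvPolynomial.map_injective _ (algebraMap K L).injective (by rw [h, map_zero]))
  obtain ⟨k, hk⟩ := exists_height_le (κ := Fin M)
    ((Fintype.card_fin M).symm ▸ hF.map (algebraMap K L)) hFL h₀
    (by simpa using hlc) hBL hAL0
    (fun k => mulVec_ne_zero_of_isUnit hAL (hz0 (β k)))
  have hroot : Polynomial.aeval (α k) B = 0 := by
    rw [← Polynomial.eval_map_algebraMap, hfac, Polynomial.eval_mul, Polynomial.eval_prod,
      Finset.prod_eq_zero (Finset.mem_univ k) (by simp), mul_zero]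
  -- A root `0` would give `F(At) = B(0) = 0`.
  have hk0 : (α k) ≠ 0 := by
    intro h0
    rw [h0, ← map_zero (algebraMap K Ω), Polynomial.aeval_algebraMap_apply,
      (algebraMap K Ω).injective.eq_iff, Polynomial.coe_aeval_eq_eval, hB,
      eval_restrictLine] at hroot
    exact hFw (by simpa using hroot)
  have hz : ∀ i, update (fun j => (t j : Ω)) i₀ (α k) i ≠ 0 := fun i => by
    by_cases hii : i = i₀
    · subst hii
      simpa using hk0
    · simpa [hii] using ht i hii
  have hy : ∀ i, (((A.map (algebraMap K L)).mulVec (update (fun j => (t j : L)) i₀ (β k)) i : L) :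
      Ω) = (A.map (algebraMap K Ω)).mulVec (update (fun j => (t j : Ω)) i₀ (α k)) i := fun i => by
    refine (RingHom.map_mulVec (algebraMap L Ω) _ _ i).trans ?_
    rw [Function.comp_update, Matrix.map_map]
    rfl
  refine ⟨update (fun j => (t j : Ω)) i₀ (α k), hz, ?_, ?_, ?_⟩
  · rw [← hBdeg]
    refine degOver_le_of_mem_adjoin_simple (α := α k) (fun i => ?_) hB0 hroot
    rw [Matrix.mulVec, dotProduct]
    refine sum_mem fun j _ => mul_mem (IntermediateField.algebraMap_mem _ _) ?_
    by_cases hj : j = i₀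
    · subst hj
      simpa using IntermediateField.mem_adjoin_simple_self K (α k)
    · simp [hj]
  · have hu : update (fun j => (t j : Ω)) i₀ (α k) =
        α k • Pi.single i₀ 1 + fun j => (t j : Ω) := by
      ext j
      by_cases hj : j = i₀
      · subst hj
        simp [h₀]
      · simp [hj]
    rw [← Polynomial.eval_map_algebraMap, hB, map_restrictLine, eval_restrictLine] at hroot
    rw [MvPolynomial.aeval_def, ← MvPolynomial.eval_map, ← hroot]
    congr 2
    rw [hu, Matrix.mulVec_add, Matrix.mulVec_smul]
    ext i
    rw [Pi.add_apply, Pi.smul_apply, smul_eq_mul, mul_comm, RingHom.map_mulVec,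
      RingHom.map_mulVec]
    congr 3
    · ext j
      by_cases hj : j = i₀
      · subst hj
        simp
      · simp [hj]
    · ext j
      simp
  · have hAΩ : IsUnit (A.map (algebraMap K Ω)) := hA.map (algebraMap K Ω).mapMatrix
    rw [algHeight_eq_height (mulVec_ne_zero_of_isUnit hAΩ fun h => hz i₀ (congrFun h i₀)) L _ hy]
    refine hk.trans_eq ?_
    rw [polyHeight_map hF0, Fintype.card_fin, matrixHeight, ← height_algebraMap (L := L) hA0]
    rfl

end Transfer

end SearchBounds

/-! ### The main theorem -/

theorem theorem1 {K : Type*} [Field K] [NumberField K]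
    {Qbar : Type*} [Field Qbar] [Algebra K Qbar] [IsAlgClosed Qbar] [Algebra.IsAlgebraic K Qbar]
    (N M : ℕ) (hN : 2 ≤ N) (hM : 1 ≤ M)
    (F : MvPolynomial (Fin N) K) (hF : F.IsHomogeneous M)
    (A : Matrix.GeneralLinearGroup (Fin N) K) :
    (∃ x : Fin N → K, x ≠ 0 ∧ MvPolynomial.eval x F = 0 ∧
      SearchBounds.height x ≤ SearchBounds.matrixHeight (A : Matrix (Fin N) (Fin N) K)) ∨
    (∃ x : Fin N → Qbar,
      (∃ z : Fin N → Qbar, (∀ i, z i ≠ 0) ∧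
        x = ((A : Matrix (Fin N) (Fin N) K).map (algebraMap K Qbar)).mulVec z) ∧
      SearchBounds.degOver K x ≤ M ∧
      MvPolynomial.aeval x F = 0 ∧
      SearchBounds.algHeight K x ≤
        SearchBounds.C₁ N M * SearchBounds.matrixHeight (A : Matrix (Fin N) (Fin N) K) ^ 2 *
          SearchBounds.polyHeight F ^ (1 / (M : ℝ))) := by
  -- The dichotomy is whether some column of `A` is a zero of `F`.
  by_cases hcol : ∃ i, MvPolynomial.eval (A.1.mulVec (Pi.single i 1)) F = 0
  · obtain ⟨i, hi⟩ := hcol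
    have hx : A.1.mulVec (Pi.single i 1) ≠ 0 :=
      SearchBounds.mulVec_ne_zero_of_isUnit A.isUnit (by simp)
    refine Or.inl ⟨_, hx, hi, ?_⟩
    have hx' : A.1.mulVec (Pi.single i 1) =
        (fun p : Fin N × Fin N => A.1 p.1 p.2) ∘ fun r => (r, i) := by
      ext r
      simp
    rw [hx'] at hx ⊢
    exact SearchBounds.height_comp_le _ (fun a b h => congrArg Prod.fst h) hx
  · push Not at hcol
    have hi : (⟨0, by omega⟩ : Fin N) ≠ ⟨1, by omega⟩ := by simp
    obtain ⟨t, h₀, h₁, ht, htM, hFt⟩ :=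
      SearchBounds.exists_intVec_eval_ne_zero hF A.1 hi (hcol _)
    obtain ⟨z, hz, hdeg, hzero, hle⟩ := SearchBounds.exists_zero_height_le (Ω := Qbar) hM hF
      A.isUnit h₀ h₁ ht (hcol _) hFt
    refine Or.inr ⟨_, ⟨z, hz, rfl⟩, hdeg, hzero, hle.trans ?_⟩
    have h1 : 0 ≤ SearchBounds.matrixHeight A.1 := SearchBounds.height_nonneg _
    have h2 : 0 ≤ SearchBounds.polyHeight F ^ (1 / (M : ℝ)) :=
      Real.rpow_nonneg (SearchBounds.height_nonneg _) _
    gcongr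
    exact SearchBounds.one_add_sum_sq_le_C₁ hN hM hi h₀ h₁ htM
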